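/- Let $Y$ be a finite-dimensional Euclidean space, $K \subseteq Y$ a closed convex cone, $K^* = \{y \in Y : \langle x, y\rangle \ge 0 \text{ for all } x \in K\}$ its dual cone, and $H \subseteq Y$ a nonempty affine subspace. A nonempty convex subset $F$ of a convex cone $C$ is a (nonempty) face of $C$ if $y, z \in C$ and $\tfrac12(y+z) \in F$ imply $y, z \in F$; $\ell_C$ denotes the maximal $k$ for which there are nonempty faces $F_1 \subsetneq F_2 \subsetneq \dots \subsetneq F_k$ of $C$. The system $H \cap K$ is infeasible if $H \cap K = \emptyset$. It is strongly infeasible if the alternative system of a representation of it is feasible: for a representation $H = \{b - Ax : x \in \mathbb{R}^m\}$ with a linear map $A : \mathbb{R}^m \to Y$ and $b \in Y$, this means that there is $y \in K^*$ with $A^*y = 0$ and $\langle b, y\rangle = -1$; for a representation $H = \{y \in Y : A^*y = c\}$ with a linear map $A : \mathbb{R}^m \to Y$ and $c \in \mathbb{R}^m$, it means that there is $x \in \mathbb{R}^m$ with $Ax \in K^*$ and $\langle c, x\rangle = -1$. (This does not depend on the representation.) It is weakly infeasible if it is infeasible but not strongly infeasible. The codimension of an affine subspace is $\dim Y$ minus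 its dimension. The same terms are used for other nonempty affine subspaces in place of $H$. Then the following hold. 1. If $H \cap K$ is infeasible, then there is an affine subspace $H' \supseteq H$ such that $\operatorname{codim} H' \le \ell_K$ and $H' \cap K$ is infeasible. 2. If $H \cap K$ is not strongly infeasible, then there is a nonempty affine subspace $H'' \subseteq H$ such that $\dim H'' \le \ell_{K^*} - 1$ and $H'' \cap K$ is not strongly infeasible. 3. If $H \cap K$ is weakly infeasible, then there are affine subspaces $H', H''$ with $\emptyset \ne H'' \subseteq H \subseteq H'$, $\operatorname{codim} H' \le \ell_K$ and $\dim H'' \le \ell_{K^*} - 1$ such that $H' \cap K$ and $H'' \cap K$ are both weakly infeasible. -/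

import Mathlib

open scoped InnerProductSpace

noncomputable section

namespace ConicSystem

variable {Y : Type*} [NormedAddCommGroup Y] [InnerProductSpace ℝ Y]

/-! ## Faces and the length of the longest chain of faces -/

/-- `F` is a nonempty face of the convex set `C`: a nonempty convex subset of `C` such that
`y, z ∈ C` and `(y + z) / 2 ∈ F` imply `y, z ∈ F`. -/
structure IsNonemptyFace (C F : Set Y) : Prop where
  nonempty : F.Nonempty
  convex : Convex ℝ F
  subset : F ⊆ C
  mem_of_midpoint : ∀ y ∈ C, ∀ z ∈ C, (1 / 2 : ℝ) • (y + z) ∈ F → y ∈ F ∧ z ∈ F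

/-- The lengths `k` of the chains `F₁ ⊊ F₂ ⊊ ⋯ ⊊ Fₖ` of nonempty faces of `C`. -/
def chainLengths (C : Set Y) : Set ℕ :=
  {k | ∃ F : Fin k → Set Y, (∀ i, IsNonemptyFace C (F i)) ∧ StrictMono F}

/-- `ℓ_K`: the maximal length of a chain of nonempty faces of the closed convex cone `K`.
The maximum exists in finite dimension, see `isGreatest_ell`. -/
def ell (K : ProperCone ℝ Y) : ℕ := sSup (chainLengths (K : Set Y))

/-- The dual cone `K* = {y | ⟪x, y⟫ ≥ 0 for all x ∈ K}`. -/
def dual [FiniteDimensional ℝ Y] (K : ProperCone ℝ Y) : ProperCone ℝ Y := ProperCone.innerDual (K : Set Y)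

/-! ## Conic linear systems and their (in)feasibility -/

section Rep

variable [FiniteDimensional ℝ Y] {m : ℕ}

/-- `H` is the affine subspace of the primal type system `b - A x ∈ K` (that is, `A x ≤_K b`). -/
def IsPrimalRep (H : AffineSubspace ℝ Y) (A : EuclideanSpace ℝ (Fin m) →ₗ[ℝ] Y) (b : Y) : Prop :=
  (H : Set Y) = {z | ∃ x, b - A x = z}

/-- The alternative of the primal type system `b - A x ∈ K` is feasible: there is `y ∈ K*` with
`A* y = 0` and `⟪b, y⟫ = -1`. -/
def PrimalAltFeasible (K : ProperCone ℝ Y) (A : EuclideanSpace ℝ (Fin m) →ₗ[ℝ] Y) (b : Y) : Prop :=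
  ∃ y ∈ dual K, LinearMap.adjoint A y = 0 ∧ ⟪b, y⟫_ℝ = -1

/-- `H` is the affine subspace of the dual type system `A* y = c`, `y ∈ K`. -/
def IsDualRep (H : AffineSubspace ℝ Y) (A : EuclideanSpace ℝ (Fin m) →ₗ[ℝ] Y)
    (c : EuclideanSpace ℝ (Fin m)) : Prop :=
  (H : Set Y) = {y | LinearMap.adjoint A y = c}

/-- The alternative of the dual type system `A* y = c`, `y ∈ K` is feasible: there is `x` with
`A x ∈ K*` and `⟪c, x⟫ = -1`. -/
def DualAltFeasible (K : ProperCone ℝ Y) (A : EuclideanSpace ℝ (Fin m) →ₗ[ℝ] Y)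
    (c : EuclideanSpace ℝ (Fin m)) : Prop :=
  ∃ x, A x ∈ dual K ∧ ⟪c, x⟫_ℝ = -1

/-- `H ∩ K` is infeasible. -/
def Infeasible (H : AffineSubspace ℝ Y) (K : ProperCone ℝ Y) : Prop :=
  (H : Set Y) ∩ (K : Set Y) = ∅

/-- `H ∩ K` is strongly infeasible: a representation of it in the primal or in the dual form has a
feasible alternative. For nonempty `H` this does not depend on the representation, see
`stronglyInfeasible_iff_primalAlt` and `stronglyInfeasible_iff_dualAlt`. -/
def StronglyInfeasible (H : AffineSubspace ℝ Y) (K : ProperCone ℝ Y) : Prop :=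
  (∃ (m : ℕ) (A : EuclideanSpace ℝ (Fin m) →ₗ[ℝ] Y) (b : Y),
      IsPrimalRep H A b ∧ PrimalAltFeasible K A b) ∨
  (∃ (m : ℕ) (A : EuclideanSpace ℝ (Fin m) →ₗ[ℝ] Y) (c : EuclideanSpace ℝ (Fin m)),
      IsDualRep H A c ∧ DualAltFeasible K A c)

/-- `H ∩ K` is weakly infeasible: it is infeasible, but not strongly infeasible. -/
def WeaklyInfeasible (H : AffineSubspace ℝ Y) (K : ProperCone ℝ Y) : Prop :=
  Infeasible H K ∧ ¬ StronglyInfeasible H K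

/-- The dimension of a (nonempty) affine subspace. -/
def affDim (H : AffineSubspace ℝ Y) : ℕ := Module.finrank ℝ H.direction

/-- The codimension of a (nonempty) affine subspace: the dimension of `Y` minus its dimension (the
subtraction never truncates). -/
def affCodim (H : AffineSubspace ℝ Y) : ℕ := Module.finrank ℝ Y - affDim H

end Rep

/-! ## The definitions are meaningful -/

section Facts

variable {C F : Set Y}

/-- A nonempty face of a cone is closed under doubling. -/
private theorem face_double {K : ProperCone ℝ Y} (hF : IsNonemptyFace (K : Set Y) F) {x : Y}
    (hx : x ∈ F) : (0 : Y) ∈ F ∧ (2 : ℝ) • x ∈ F := by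
  have hxK := hF.subset hx
  have h2 : (2 : ℝ) • x ∈ (K : Set Y) := by
    rw [two_smul]
    exact K.add_mem hxK hxK
  refine hF.mem_of_midpoint 0 K.zero_mem _ h2 ?_
  rw [zero_add, smul_smul]
  norm_num
  exact hx

private theorem face_add {K : ProperCone ℝ Y} (hF : IsNonemptyFace (K : Set Y) F) {x y : Y}
    (hx : x ∈ F) (hy : y ∈ F) : x + y ∈ F := by
  have h := hF.convex hx hy (a := 1 / 2) (b := 1 / 2) (by norm_num) (by norm_num) (by norm_num)
  have h' := (face_double hF h).2
  rw [smul_add, smul_smul, smul_smul] at h'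
  norm_num at h'
  exact h'

private theorem face_smul {K : ProperCone ℝ Y} (hF : IsNonemptyFace (K : Set Y) F) {x : Y}
    (hx : x ∈ F) {t : ℝ} (ht : 0 ≤ t) : t • x ∈ F := by
  obtain ⟨n, hn⟩ := exists_nat_ge t
  have hnat : ∀ n : ℕ, (n : ℝ) • x ∈ F := by
    intro n
    induction n with
    | zero => simpa using (face_double hF hx).1
    | succ k ih =>
      rw [Nat.cast_succ, add_smul, one_smul]
      exact face_add hF ih hx
  rcases ht.eq_or_lt with rfl | ht0
  · simpa using (face_double hF hx).1
  have hn0 : (0 : ℝ) < n := ht0.trans_le hn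
  have h := hF.convex (hnat n) (face_double hF hx).1 (a := t / n) (b := 1 - t / n)
    (by positivity) (by rw [sub_nonneg]; exact (div_le_one hn0).2 hn) (by ring)
  rw [smul_zero, add_zero, smul_smul, div_mul_cancel₀ _ hn0.ne'] at h
  exact h

private theorem mem_span_face {K : ProperCone ℝ Y} (hF : IsNonemptyFace (K : Set Y) F) {x : Y}
    (hx : x ∈ Submodule.span ℝ F) : ∃ a ∈ F, ∃ b ∈ F, x = a - b := by
  obtain ⟨f, hf⟩ := hF.nonempty
  have h0 := (face_double hF hf).1
  induction hx using Submodule.span_induction with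
  | mem x hx => exact ⟨x, hx, 0, h0, by simp⟩
  | zero => exact ⟨0, h0, 0, h0, by simp⟩
  | add x y _ _ hx hy =>
    obtain ⟨a, ha, b, hb, rfl⟩ := hx
    obtain ⟨c, hc, d, hd, rfl⟩ := hy
    exact ⟨a + c, face_add hF ha hc, b + d, face_add hF hb hd, by abel⟩
  | smul t x _ hx =>
    obtain ⟨a, ha, b, hb, rfl⟩ := hx
    rcases le_total 0 t with ht | ht
    · exact ⟨t • a, face_smul hF ha ht, t • b, face_smul hF hb ht, smul_sub _ _ _⟩
    · refine ⟨(-t) • b, face_smul hF hb (by linarith), (-t) • a, face_smul hF ha (by linarith), ?_⟩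
      rw [← smul_sub, neg_smul, ← smul_neg, neg_sub]

/-- A nonempty face of a cone is the intersection of the cone with its linear span. -/
theorem face_eq_inter_span {K : ProperCone ℝ Y} (hF : IsNonemptyFace (K : Set Y) F) :
    F = (K : Set Y) ∩ Submodule.span ℝ F := by
  refine Set.Subset.antisymm (fun x hx => ⟨hF.subset hx, Submodule.subset_span hx⟩) ?_
  rintro x ⟨hxK, hx⟩
  obtain ⟨a, ha, b, hb, rfl⟩ := mem_span_face hF hx
  refine (hF.mem_of_midpoint _ hxK b (hF.subset hb) ?_).1
  rw [sub_add_cancel]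
  exact face_smul hF ha (by norm_num)

variable [FiniteDimensional ℝ Y]

/-- `ℓ_K` is attained: it is the maximal length of a chain of nonempty faces. -/
theorem isGreatest_ell (K : ProperCone ℝ Y) :
    IsGreatest (chainLengths (K : Set Y)) (ell K) := by
  have hb : ∀ k ∈ chainLengths (K : Set Y), k ≤ Module.finrank ℝ Y + 1 := by
    rintro k ⟨F, hF, hmono⟩
    have hlt : ∀ i j, i < j → Module.finrank ℝ (Submodule.span ℝ (F i)) <
        Module.finrank ℝ (Submodule.span ℝ (F j)) := by
      intro i j hij
      refine Submodule.finrank_lt_finrank_of_lt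
        (lt_of_le_of_ne (Submodule.span_mono (hmono hij).le) fun h => (hmono hij).ne ?_)
      rw [face_eq_inter_span (hF i), face_eq_inter_span (hF j), h]
    have hinj : Function.Injective fun i : Fin k =>
        (⟨Module.finrank ℝ (Submodule.span ℝ (F i)),
          Nat.lt_succ_of_le (Submodule.finrank_le _)⟩ : Fin (Module.finrank ℝ Y + 1)) := by
      intro i j h
      have h' := congrArg Fin.val h
      rcases lt_trichotomy i j with hij | hij | hij
      · exact absurd h' (hlt i j hij).ne
      · exact hij
      · exact absurd h'.symm (hlt j i hij).ne
    simpa using Fintype.card_le_of_injective _ hinj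
  have hbdd : BddAbove (chainLengths (K : Set Y)) := ⟨_, hb⟩
  have hne : (chainLengths (K : Set Y)).Nonempty :=
    ⟨0, fun i => i.elim0, fun i => i.elim0, fun i => i.elim0⟩
  exact ⟨Nat.sSup_mem hne hbdd, fun k hk => le_csSup hbdd hk⟩

variable {m : ℕ} {H : AffineSubspace ℝ Y} {K : ProperCone ℝ Y}
  {A : EuclideanSpace ℝ (Fin m) →ₗ[ℝ] Y}

private theorem primalAlt_iff {b : Y} (h : IsPrimalRep H A b) :
    PrimalAltFeasible K A b ↔ ∃ y ∈ dual K, ∀ z ∈ H, ⟪z, y⟫_ℝ = -1 := by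
  have hmem : ∀ z, z ∈ H ↔ ∃ x, b - A x = z := fun z => Set.ext_iff.1 h z
  refine exists_congr fun y => and_congr_right fun _ => ?_
  constructor
  · rintro ⟨hA, hb⟩ z hz
    obtain ⟨x, rfl⟩ := (hmem z).1 hz
    rw [inner_sub_left, ← LinearMap.adjoint_inner_right, hA, inner_zero_right, hb, sub_zero]
  · intro hy
    have hb : ⟪b, y⟫_ℝ = -1 := hy b ((hmem b).2 ⟨0, by simp⟩)
    refine ⟨ext_inner_left ℝ fun x => ?_, hb⟩
    have hx := hy _ ((hmem _).2 ⟨x, rfl⟩)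
    rw [inner_sub_left, hb] at hx
    rw [LinearMap.adjoint_inner_right, inner_zero_right]
    linarith

private theorem dualAlt_iff {c : EuclideanSpace ℝ (Fin m)} (hH : (H : Set Y).Nonempty)
    (h : IsDualRep H A c) :
    DualAltFeasible K A c ↔ ∃ y ∈ dual K, ∀ z ∈ H, ⟪z, y⟫_ℝ = -1 := by
  have hmem : ∀ z, z ∈ H ↔ LinearMap.adjoint A z = c := fun z => Set.ext_iff.1 h z
  obtain ⟨z₀, hz₀⟩ := hH
  have hz₀c := (hmem z₀).1 hz₀
  constructor
  · rintro ⟨x, hx, hc⟩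
    refine ⟨A x, hx, fun z hz => ?_⟩
    rw [← LinearMap.adjoint_inner_left, (hmem z).1 hz, hc]
  · rintro ⟨y, hy, hyH⟩
    have hyr : y ∈ LinearMap.range A := by
      rw [← Submodule.orthogonal_orthogonal (LinearMap.range A), Submodule.mem_orthogonal]
      intro u hu
      have hAu : LinearMap.adjoint A u = 0 := by
        refine ext_inner_right ℝ fun x => ?_
        rw [LinearMap.adjoint_inner_left, inner_zero_left, real_inner_comm]
        exact (Submodule.mem_orthogonal _ _).1 hu _ ⟨x, rfl⟩
      have h1 := hyH (z₀ + u) ((hmem _).2 (by rw [map_add, hAu, add_zero, hz₀c]))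
      rw [inner_add_left, hyH z₀ hz₀] at h1
      linarith
    obtain ⟨x, rfl⟩ := hyr
    refine ⟨x, hy, ?_⟩
    rw [← hz₀c, LinearMap.adjoint_inner_left]
    exact hyH z₀ hz₀

private theorem exists_primalRep (hH : (H : Set Y).Nonempty) :
    ∃ (m : ℕ) (A : EuclideanSpace ℝ (Fin m) →ₗ[ℝ] Y) (b : Y), IsPrimalRep H A b := by
  obtain ⟨b, hb⟩ := hH
  let e := (stdOrthonormalBasis ℝ H.direction).repr.toLinearEquiv.symm
  refine ⟨_, H.direction.subtype ∘ₗ e.toLinearMap, b, Set.ext fun z => ?_⟩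
  constructor
  · intro hz
    refine ⟨e.symm ⟨b -ᵥ z, AffineSubspace.vsub_mem_direction hb hz⟩, ?_⟩
    simp
  · rintro ⟨x, rfl⟩
    have := AffineSubspace.vadd_mem_of_mem_direction (H.direction.neg_mem (e x).2) hb
    simpa [sub_eq_neg_add] using this

/-- Strong infeasibility of `H ∩ K` for a nonempty `H`, without a representation. -/
theorem stronglyInfeasible_iff (hH : (H : Set Y).Nonempty) :
    StronglyInfeasible H K ↔ ∃ y ∈ dual K, ∀ z ∈ H, ⟪z, y⟫_ℝ = -1 := by
  constructor
  · rintro (⟨m, A, b, h, ha⟩ | ⟨m, A, c, h, ha⟩)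
    · exact (primalAlt_iff h).1 ha
    · exact (dualAlt_iff hH h).1 ha
  · intro hy
    obtain ⟨m, A, b, h⟩ := exists_primalRep hH
    exact Or.inl ⟨m, A, b, h, (primalAlt_iff h).2 hy⟩

/-- Strong infeasibility may be checked on any primal type representation. -/
theorem stronglyInfeasible_iff_primalAlt (hH : (H : Set Y).Nonempty) {b : Y}
    (h : IsPrimalRep H A b) : StronglyInfeasible H K ↔ PrimalAltFeasible K A b := by
  rw [stronglyInfeasible_iff hH, primalAlt_iff h]

/-- Strong infeasibility may be checked on any dual type representation. -/
theorem stronglyInfeasible_iff_dualAlt (hH : (H : Set Y).Nonempty)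
    {c : EuclideanSpace ℝ (Fin m)} (h : IsDualRep H A c) :
    StronglyInfeasible H K ↔ DualAltFeasible K A c := by
  rw [stronglyInfeasible_iff hH, dualAlt_iff hH h]

end Facts

end ConicSystem

end

/-!
An infeasible system is certified by facial reduction. If the affine subspace `H` misses the cone
`K`, proper separation (`infeasible_alternative`) gives `y ∈ K*` which is constant on `H`: either
its value is negative, and after scaling `y` certifies strong infeasibility, or its value is `0` and
`K ∩ y^⊥` is a proper face of `K` which still misses `H`. In the second case `K` is replaced by this
face. Every step uses one hyperplane containing `H` and shortens the longest chain of faces, so at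
most `ℓ_K` hyperplanes are used; their intersection is `H'` (`exists_infeasible_affCodim_le_ell`).

The bound for `H''` follows by polarity. The points `y` with `⟪z, y⟫ = -1` for all `z ∈ H` form an
affine subspace, `polarAffine H`, and `H ∩ K` is strongly infeasible exactly if this subspace meets
`K*`. If it does not, the first part, applied to `K*`, enlarges it to a subspace `G` of codimension
at most `ℓ_{K*}` that still misses `K*`. Since `0 ∈ K*`, the subspace `G` avoids the origin, so
polarity is an involution on it which trades codimension for dimension plus one, and `polarAffine G`
is the required subspace of `H`. If `0 ∈ H`, the polar is empty and `{0}` serves as `H''`.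

Subspaces of an infeasible subspace are infeasible, and strong infeasibility passes to nonempty
subspaces, so weak infeasibility is kept in both constructions.
-/

open scoped Pointwise

namespace ConicSystem

variable {Y : Type*} [NormedAddCommGroup Y] [InnerProductSpace ℝ Y]

/-! ### Proper separation of the origin from a convex set -/

/-- `S` is not assumed closed, so the inequality cannot be strict in general. The vector is obtained
by compactness of the unit sphere: finitely many points of `S` span a compact polytope avoiding the
origin, which is strictly separated from it. -/
theorem exists_unit_inner_nonneg [FiniteDimensional ℝ Y] {S : Set Y} (hS : Convex ℝ S)
    (hne : S.Nonempty) (h0 : (0 : Y) ∉ S) : ∃ y : Y, ‖y‖ = 1 ∧ ∀ s ∈ S, 0 ≤ ⟪s, y⟫_ℝ := by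
  obtain ⟨s₀, hs₀⟩ := hne
  have key := (isCompact_sphere (0 : Y) 1).inter_iInter_nonempty
    (fun s : S => {y : Y | 0 ≤ ⟪(s : Y), y⟫_ℝ})
    (fun s => isClosed_le continuous_const (by fun_prop)) ?_
  · obtain ⟨y, hy, hyS⟩ := key
    exact ⟨y, by simpa using hy, fun s hs => Set.mem_iInter.1 hyS ⟨s, hs⟩⟩
  · intro u
    -- The extra point `s₀` makes the separating functional nonzero when `u` is empty.
    set T : Set Y := insert s₀ ((↑) '' (u : Set S)) with hT
    have hfin : T.Finite := (u.finite_toSet.image _).insert _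
    have hTS : convexHull ℝ T ⊆ S := by
      refine convexHull_min (Set.insert_subset hs₀ ?_) hS
      rintro _ ⟨s, -, rfl⟩
      exact s.2
    obtain ⟨f, a, ha, hf⟩ := geometric_hahn_banach_point_closed (convex_convexHull ℝ T)
      (hfin.isCompact_convexHull ℝ).isClosed (fun h => h0 (hTS h))
    rw [map_zero] at ha
    set y := (InnerProductSpace.toDual ℝ Y).symm f with hy
    have hpos : ∀ t ∈ T, 0 < ⟪t, y⟫_ℝ := by
      intro t ht
      rw [real_inner_comm, hy, InnerProductSpace.toDual_symm_apply]
      exact ha.trans (hf t (subset_convexHull ℝ T ht))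
    have hy0 : y ≠ 0 := by
      intro h
      simpa [h] using hpos s₀ (Set.mem_insert _ _)
    refine ⟨‖y‖⁻¹ • y, by simp [norm_smul, hy0], Set.mem_iInter₂.2 fun s hs => ?_⟩
    have := hpos s (Set.mem_insert_of_mem _ ⟨s, hs, rfl⟩)
    change 0 ≤ ⟪(s : Y), ‖y‖⁻¹ • y⟫_ℝ
    rw [inner_smul_right]
    positivity

/-- The separation is proper because the separating vector is chosen in the linear span of `S`, so
that it cannot be orthogonal to all of `S`. -/
theorem exists_inner_nonneg_and_pos [FiniteDimensional ℝ Y] {S : Set Y} (hS : Convex ℝ S)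
    (hne : S.Nonempty) (h0 : (0 : Y) ∉ S) :
    ∃ y : Y, (∀ s ∈ S, 0 ≤ ⟪s, y⟫_ℝ) ∧ ∃ s ∈ S, 0 < ⟪s, y⟫_ℝ := by
  let V := Submodule.span ℝ S
  have hV : ∀ s ∈ S, s ∈ V := fun s hs => Submodule.subset_span hs
  obtain ⟨s₀, hs₀⟩ := hne
  obtain ⟨y, hy1, hy⟩ := exists_unit_inner_nonneg (S := V.subtype ⁻¹' S)
    (hS.linear_preimage V.subtype) ⟨⟨s₀, hV s₀ hs₀⟩, hs₀⟩ (by simpa using h0)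
  refine ⟨y, fun s hs => hy ⟨s, hV s hs⟩ hs, ?_⟩
  by_contra! hle
  have hperp : (y : Y) ∈ Vᗮ := by
    refine Submodule.mem_orthogonal _ _ |>.2 fun v hv => ?_
    induction hv using Submodule.span_induction with
    | mem s hs => exact le_antisymm (hle s hs) (hy ⟨s, hV s hs⟩ hs)
    | zero => exact inner_zero_left _
    | add a b _ _ ha hb => rw [inner_add_left, ha, hb, add_zero]
    | smul t a _ ha => rw [inner_smul_left, ha, mul_zero]
  have : ⟪(y : Y), (y : Y)⟫_ℝ = 0 := (Submodule.mem_orthogonal _ _).1 hperp y y.2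
  rw [inner_self_eq_zero] at this
  have hy0 : y = 0 := Subtype.ext this
  simp [hy0] at hy1

theorem inner_eq_of_bddAbove {H : AffineSubspace ℝ Y} {y : Y} {c : ℝ}
    (hc : ∀ z ∈ H, ⟪z, y⟫_ℝ ≤ c) {z w : Y} (hz : z ∈ H) (hw : w ∈ H) : ⟪z, y⟫_ℝ = ⟪w, y⟫_ℝ := by
  by_contra hne
  have hd : ⟪z - w, y⟫_ℝ ≠ 0 := by rwa [inner_sub_left, sub_ne_zero]
  have hmem : ((c - ⟪w, y⟫_ℝ + 1) / ⟪z - w, y⟫_ℝ) • (z - w) + w ∈ H := by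
    simpa using H.smul_vsub_vadd_mem ((c - ⟪w, y⟫_ℝ + 1) / ⟪z - w, y⟫_ℝ) hz hw hw
  have := hc _ hmem
  rw [inner_add_left, inner_smul_left, RCLike.conj_to_real, div_mul_cancel₀ _ hd] at this
  linarith

theorem convex_properCone (K : ProperCone ℝ Y) : Convex ℝ (K : Set Y) :=
  fun _ ha _ hb _ _ hs ht _ => K.add_mem (K.smul_mem ha hs) (K.smul_mem hb ht)

/-- The basic step of facial reduction: proper separation of `K` from a disjoint affine subspace
`H`. Either the alternative system is feasible, or `H` lies in a supporting hyperplane of `K` that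
does not contain `K`. -/
theorem infeasible_alternative [FiniteDimensional ℝ Y] {K : ProperCone ℝ Y}
    {H : AffineSubspace ℝ Y} (hH : (H : Set Y).Nonempty) (hinf : Infeasible H K) :
    ∃ y ∈ dual K, (∀ z ∈ H, ⟪z, y⟫_ℝ = -1) ∨
      ((∀ z ∈ H, ⟪z, y⟫_ℝ = 0) ∧ ∃ k ∈ K, 0 < ⟪k, y⟫_ℝ) := by
  obtain ⟨z₀, hz₀⟩ := hH
  have hK0 : (0 : Y) ∈ K := K.zero_mem
  obtain ⟨y, hy, s, ⟨k, hk, w, hw, rfl⟩, hpos⟩ := exists_inner_nonneg_and_pos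
    ((convex_properCone K).sub H.convex) ⟨0 - z₀, Set.sub_mem_sub hK0 hz₀⟩ (by
      rintro ⟨k, hk, w, hw, h⟩
      obtain rfl : k = w := sub_eq_zero.1 h
      exact Set.notMem_empty k (hinf ▸ ⟨hw, hk⟩))
  have hle : ∀ k ∈ K, ∀ w ∈ H, ⟪w, y⟫_ℝ ≤ ⟪k, y⟫_ℝ := by
    intro k hk w hw
    have := hy _ (Set.sub_mem_sub hk hw)
    rwa [inner_sub_left, sub_nonneg] at this
  have hconst : ∀ z ∈ H, ⟪z, y⟫_ℝ = ⟪z₀, y⟫_ℝ := fun z hz => inner_eq_of_bddAbove (hle 0 hK0) hz hz₀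
  have hc : ⟪z₀, y⟫_ℝ ≤ 0 := by simpa using hle 0 hK0 z₀ hz₀
  have hdual : y ∈ dual K := by
    refine ProperCone.mem_innerDual.2 fun x hx => ?_
    by_contra! hneg
    -- A negative value on `x` would make `y` unbounded below on the ray through `x`.
    have hmem : 0 ≤ (⟪z₀, y⟫_ℝ - 1) / ⟪x, y⟫_ℝ := div_nonneg_of_nonpos (by linarith) hneg.le
    have := hle (((⟪z₀, y⟫_ℝ - 1) / ⟪x, y⟫_ℝ) • x) (K.smul_mem hx hmem) z₀ hz₀
    rw [inner_smul_left, RCLike.conj_to_real, div_mul_cancel₀ _ hneg.ne] at this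
    linarith
  rcases hc.lt_or_eq with hlt | heq
  · have hnn : 0 ≤ (-⟪z₀, y⟫_ℝ)⁻¹ := inv_nonneg.2 (by linarith)
    refine ⟨(-⟪z₀, y⟫_ℝ)⁻¹ • y, (dual K).smul_mem hdual hnn, Or.inl fun z hz => ?_⟩
    rw [inner_smul_right, hconst z hz, inv_neg, neg_mul, inv_mul_cancel₀ hlt.ne]
  · refine ⟨y, hdual, Or.inr ⟨fun z hz => (hconst z hz).trans heq, k, hk, ?_⟩⟩
    have h := hpos
    simp only [inner_sub_left, hconst w hw, heq, sub_zero] at h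
    exact h

/-! ### Faces and the length of chains of faces -/

theorem isNonemptyFace_self (K : ProperCone ℝ Y) : IsNonemptyFace (K : Set Y) (K : Set Y) :=
  ⟨⟨0, K.zero_mem⟩, convex_properCone K, subset_rfl, fun _ hy _ hz _ => ⟨hy, hz⟩⟩

theorem IsNonemptyFace.trans {A B C : Set Y} (hB : IsNonemptyFace A B) (hC : IsNonemptyFace B C) :
    IsNonemptyFace A C where
  nonempty := hC.nonempty
  convex := hC.convex
  subset := hC.subset.trans hB.subset
  mem_of_midpoint y hy z hz h :=
    have hyz := hB.mem_of_midpoint y hy z hz (hC.subset h)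
    hC.mem_of_midpoint y hyz.1 z hyz.2 h

theorem one_le_ell [FiniteDimensional ℝ Y] (K : ProperCone ℝ Y) : 1 ≤ ell K :=
  (isGreatest_ell K).2 ⟨fun _ => K, fun _ => isNonemptyFace_self K, Subsingleton.strictMono _⟩

/-- A longest chain of faces of a proper face extends by the whole cone. -/
theorem ell_add_one_le [FiniteDimensional ℝ Y] {K L : ProperCone ℝ Y}
    (hL : IsNonemptyFace (K : Set Y) (L : Set Y))
    (hne : (L : Set Y) ≠ K) : ell L + 1 ≤ ell K := by
  obtain ⟨F, hF, hmono⟩ := (isGreatest_ell L).1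
  refine (isGreatest_ell K).2 ⟨Fin.snoc (α := fun _ => Set Y) F (K : Set Y), fun i => ?_, ?_⟩
  · induction i using Fin.lastCases with
    | last => simpa using isNonemptyFace_self K
    | cast i => simpa using hL.trans (hF i)
  · have hlt : ∀ i, F i < (K : Set Y) := fun i =>
      lt_of_le_of_lt (hF i).subset (lt_of_le_of_ne hL.subset hne)
    intro i j hij
    induction j using Fin.lastCases with
    | last =>
      induction i using Fin.lastCases with
      | last => exact absurd hij (lt_irrefl _)
      | cast i => simpa using hlt i
    | cast j =>
      induction i using Fin.lastCases with
      | last => exact absurd hij (Fin.le_last _).not_gt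
      | cast i => simpa using hmono (by simpa using hij)

/-- The face `K ∩ y^⊥` of `K` exposed by `y ∈ K*`. It is encoded as the part of `K` where `-y` is
nonnegative, which is the same because `y` is nonnegative on `K`. -/
noncomputable def exposedFace [FiniteDimensional ℝ Y] (K : ProperCone ℝ Y) (y : Y) :
    ProperCone ℝ Y :=
  K ⊓ ProperCone.innerDual {-y}

theorem mem_exposedFace [FiniteDimensional ℝ Y] {K : ProperCone ℝ Y} {y : Y} (hy : y ∈ dual K)
    {x : Y} :
    x ∈ exposedFace K y ↔ x ∈ K ∧ ⟪x, y⟫_ℝ = 0 := by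
  rw [exposedFace, ClosedSubmodule.mem_inf]
  refine and_congr_right fun hx => ?_
  have h : 0 ≤ ⟪x, y⟫_ℝ := ProperCone.mem_innerDual.1 hy hx
  simp only [ProperCone.mem_innerDual, Set.mem_singleton_iff, forall_eq, inner_neg_left,
    real_inner_comm x y]
  constructor <;> intro h' <;> linarith

theorem isNonemptyFace_exposedFace [FiniteDimensional ℝ Y] {K : ProperCone ℝ Y} {y : Y}
    (hy : y ∈ dual K) :
    IsNonemptyFace (K : Set Y) (exposedFace K y : Set Y) where
  nonempty := ⟨0, (exposedFace K y).zero_mem⟩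
  convex := convex_properCone _
  subset _ hx := ((mem_exposedFace hy).1 hx).1
  mem_of_midpoint a ha b hb h := by
    have h0 := ((mem_exposedFace hy).1 h).2
    rw [inner_smul_left, inner_add_left, RCLike.conj_to_real] at h0
    have ha0 : 0 ≤ ⟪a, y⟫_ℝ := ProperCone.mem_innerDual.1 hy ha
    have hb0 : 0 ≤ ⟪b, y⟫_ℝ := ProperCone.mem_innerDual.1 hy hb
    exact ⟨(mem_exposedFace hy).2 ⟨ha, by linarith⟩, (mem_exposedFace hy).2 ⟨hb, by linarith⟩⟩

/-! ### Codimension and facial reduction -/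

theorem affCodim_mk'_orthogonal_le [FiniteDimensional ℝ Y] (z y : Y) :
    affCodim (AffineSubspace.mk' z (ℝ ∙ y)ᗮ) ≤ 1 := by
  have h1 := (ℝ ∙ y).finrank_add_finrank_orthogonal
  have h2 := finrank_span_le_card (R := ℝ) ({y} : Set Y)
  simp only [Set.toFinset_singleton, Finset.card_singleton] at h2
  rw [affCodim, affDim, AffineSubspace.direction_mk']
  omega

theorem affCodim_inf_le [FiniteDimensional ℝ Y] {S T : AffineSubspace ℝ Y} {z : Y} (hS : z ∈ S)
    (hT : z ∈ T) :
    affCodim (S ⊓ T) ≤ affCodim S + affCodim T := by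
  have h1 := Submodule.finrank_sup_add_finrank_inf_eq S.direction T.direction
  have h2 := Submodule.finrank_le (S.direction ⊔ T.direction)
  rw [affCodim, affCodim, affCodim, affDim, affDim, affDim,
    AffineSubspace.direction_inf_of_mem hS hT]
  omega

theorem mem_mk'_orthogonal {z y x : Y} :
    x ∈ AffineSubspace.mk' z (ℝ ∙ y)ᗮ ↔ ⟪x, y⟫_ℝ = ⟪z, y⟫_ℝ := by
  rw [AffineSubspace.mem_mk', Submodule.mem_orthogonal_singleton_iff_inner_left, vsub_eq_sub,
    inner_sub_left, sub_eq_zero]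

/-- Facial reduction. Each step that does not end with a strong certificate of infeasibility costs
one hyperplane and replaces `K` by a proper face, which makes the longest chain of faces shorter. -/
theorem exists_infeasible_affCodim_le_ell [FiniteDimensional ℝ Y] {K : ProperCone ℝ Y}
    {H : AffineSubspace ℝ Y}
    (hH : (H : Set Y).Nonempty) (hinf : Infeasible H K) :
    ∃ H' : AffineSubspace ℝ Y, H ≤ H' ∧ affCodim H' ≤ ell K ∧ Infeasible H' K := by
  induction hn : ell K using Nat.strong_induction_on generalizing K with
  | _ n ih =>
  subst hn
  obtain ⟨z, hz⟩ := hH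
  obtain ⟨y, hy, hneg | ⟨hzero, k, hk, hpos⟩⟩ := infeasible_alternative ⟨z, hz⟩ hinf
  · refine ⟨AffineSubspace.mk' z (ℝ ∙ y)ᗮ, fun w hw => ?_,
      (affCodim_mk'_orthogonal_le z y).trans (one_le_ell K), ?_⟩
    · rw [mem_mk'_orthogonal, hneg z hz, hneg w hw]
    · refine Set.eq_empty_iff_forall_notMem.2 fun x ⟨hx, hxK⟩ => ?_
      have h1 := mem_mk'_orthogonal.1 hx
      have h2 : 0 ≤ ⟪x, y⟫_ℝ := ProperCone.mem_innerDual.1 hy hxK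
      rw [hneg z hz] at h1
      linarith
  · have hsub := (isNonemptyFace_exposedFace hy).subset
    have hell : ell (exposedFace K y) + 1 ≤ ell K := by
      refine ell_add_one_le (isNonemptyFace_exposedFace hy) fun h => hpos.ne' ?_
      exact ((mem_exposedFace hy).1 (h.ge hk)).2
    obtain ⟨H', hHH', hcod, hinf'⟩ := ih _ hell
      (Set.eq_empty_of_subset_empty (hinf ▸ Set.inter_subset_inter_right _ hsub)) rfl
    have hle : H ≤ AffineSubspace.mk' z (ℝ ∙ y)ᗮ := fun w hw => by
      rw [mem_mk'_orthogonal, hzero z hz, hzero w hw]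
    refine ⟨H' ⊓ AffineSubspace.mk' z (ℝ ∙ y)ᗮ, le_inf hHH' hle, ?_, ?_⟩
    · have h1 := affCodim_inf_le (hHH' hz) (hle hz)
      have h2 := affCodim_mk'_orthogonal_le z y
      omega
    · refine Set.eq_empty_iff_forall_notMem.2 fun x ⟨hx, hxK⟩ => ?_
      obtain ⟨hx1, hx2⟩ := (AffineSubspace.mem_inf_iff _ _ _).1 hx
      have hxF := (mem_exposedFace hy).2 ⟨hxK, (mem_mk'_orthogonal.1 hx2).trans (hzero z hz)⟩
      exact Set.notMem_empty x (hinf' ▸ ⟨hx1, hxF⟩)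

/-! ### Polarity of affine subspaces -/

/-- The affine subspace of all `z` with `⟪z, y⟫ = -1` on `G`. With `H` in place of `G` it consists
of the `y` which, when in `K*`, certify that `H ∩ K` is strongly infeasible. The value `-1` is the
normalization of the alternative systems. It is empty if `0 ∈ G`. -/
def polarAffine (G : AffineSubspace ℝ Y) : AffineSubspace ℝ Y where
  carrier := {z | ∀ y ∈ G, ⟪z, y⟫_ℝ = -1}
  smul_vsub_vadd_mem' c p₁ p₂ p₃ h₁ h₂ h₃ y hy := by
    simp only [vsub_eq_sub, vadd_eq_add, inner_add_left, inner_smul_left, inner_sub_left,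
      h₁ y hy, h₂ y hy, h₃ y hy, sub_self, mul_zero, zero_add]

theorem polarAffine_anti {G G' : AffineSubspace ℝ Y} (h : G ≤ G') :
    polarAffine G' ≤ polarAffine G := fun _ hz y hy => hz y (h hy)

/-- The witness is the point of `G` of minimal norm. -/
theorem exists_mem_direction_orthogonal [FiniteDimensional ℝ Y] {G : AffineSubspace ℝ Y}
    (hG : (G : Set Y).Nonempty) :
    ∃ p ∈ G, p ∈ G.directionᗮ := by
  obtain ⟨b, hb⟩ := hG
  refine ⟨b - G.direction.starProjection b, ?_, Submodule.sub_starProjection_mem_orthogonal b⟩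
  have := AffineSubspace.vadd_mem_of_mem_direction
    (G.direction.neg_mem (G.direction.starProjection_apply_mem b)) hb
  rwa [vadd_eq_add, neg_add_eq_sub] at this

theorem inner_eq_of_mem_direction_orthogonal {G : AffineSubspace ℝ Y} {u y p : Y}
    (hu : u ∈ G.directionᗮ) (hy : y ∈ G) (hp : p ∈ G) : ⟪u, y⟫_ℝ = ⟪u, p⟫_ℝ := by
  have := (Submodule.mem_orthogonal' _ _).1 hu _ (AffineSubspace.vsub_mem_direction hy hp)
  rwa [vsub_eq_sub, inner_sub_right, sub_eq_zero] at this

theorem smul_mem_polarAffine [FiniteDimensional ℝ Y] {G : AffineSubspace ℝ Y} {p : Y} (hp : p ∈ G)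
    (hpo : p ∈ G.directionᗮ) (hp0 : p ≠ 0) : (-(⟪p, p⟫_ℝ)⁻¹) • p ∈ polarAffine G := fun y hy => by
  rw [inner_smul_left, inner_eq_of_mem_direction_orthogonal hpo hy hp, RCLike.conj_to_real,
    neg_mul, inv_mul_cancel₀ (inner_self_ne_zero.2 hp0)]

theorem polarAffine_nonempty [FiniteDimensional ℝ Y] {G : AffineSubspace ℝ Y}
    (hG : (G : Set Y).Nonempty)
    (h0 : (0 : Y) ∉ G) : (polarAffine G : Set Y).Nonempty := by
  obtain ⟨p, hp, hpo⟩ := exists_mem_direction_orthogonal hG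
  exact ⟨_, smul_mem_polarAffine hp hpo (by rintro rfl; exact h0 hp)⟩

theorem polarAffine_polarAffine [FiniteDimensional ℝ Y] {G : AffineSubspace ℝ Y}
    (hG : (G : Set Y).Nonempty)
    (h0 : (0 : Y) ∉ G) : polarAffine (polarAffine G) = G := by
  refine le_antisymm (fun y hy => ?_) fun y hy z hz => (real_inner_comm _ _).trans (hz y hy)
  obtain ⟨p, hp, hpo⟩ := exists_mem_direction_orthogonal hG
  have hp0 : p ≠ 0 := by rintro rfl; exact h0 hp
  have hpp : ⟪p, p⟫_ℝ ≠ 0 := inner_self_ne_zero.2 hp0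
  have hz₀ := smul_mem_polarAffine hp hpo hp0
  have hyp : ⟪y, p⟫_ℝ = ⟪p, p⟫_ℝ := by
    have := hy _ hz₀
    rw [inner_smul_right] at this
    field_simp at this
    linarith
  -- `directionᗮ` is spanned by `p` and by the directions in which the polar extends.
  have hdir : y - p ∈ G.direction := by
    rw [← Submodule.orthogonal_orthogonal G.direction, Submodule.mem_orthogonal]
    intro u hu
    set a := ⟪u, p⟫_ℝ / ⟪p, p⟫_ℝ with ha
    have hw : u - a • p ∈ G.directionᗮ := sub_mem hu (Submodule.smul_mem _ _ hpo)
    have hwp : ⟪u - a • p, p⟫_ℝ = 0 := by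
      rw [inner_sub_left, inner_smul_left, RCLike.conj_to_real, ha, div_mul_cancel₀ _ hpp, sub_self]
    have hmem : (-(⟪p, p⟫_ℝ)⁻¹) • p + (u - a • p) ∈ polarAffine G := fun g hg => by
      rw [inner_add_left, hz₀ g hg, inner_eq_of_mem_direction_orthogonal hw hg hp, hwp, add_zero]
    have hwy : ⟪y, u - a • p⟫_ℝ = 0 := by
      have := hy _ hmem
      rw [inner_add_right, hy _ hz₀] at this
      linarith
    rw [inner_sub_right, inner_smul_right, hyp] at hwy
    rw [real_inner_comm, inner_sub_left, real_inner_comm u p]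
    rw [ha, div_mul_cancel₀ _ hpp] at hwy
    exact hwy
  simpa using AffineSubspace.vadd_mem_of_mem_direction hdir hp

theorem affDim_polarAffine_lt [FiniteDimensional ℝ Y] {G : AffineSubspace ℝ Y}
    (hG : (G : Set Y).Nonempty)
    (h0 : (0 : Y) ∉ G) : affDim (polarAffine G) < affCodim G := by
  obtain ⟨p, hp, hpo⟩ := exists_mem_direction_orthogonal hG
  have hp0 : p ≠ 0 := by rintro rfl; exact h0 hp
  have hz₀ := smul_mem_polarAffine hp hpo hp0
  -- Directions of the polar are orthogonal to `G` itself, not only to its direction.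
  have hperp : ∀ u ∈ (polarAffine G).direction, ∀ g ∈ G, ⟪u, g⟫_ℝ = 0 := by
    intro u hu g hg
    have := AffineSubspace.vadd_mem_of_mem_direction hu hz₀ g hg
    rw [vadd_eq_add, inner_add_left, hz₀ g hg] at this
    linarith
  have hlt : (polarAffine G).direction < G.directionᗮ := by
    refine lt_of_le_of_ne (fun u hu => (Submodule.mem_orthogonal' _ _).2 fun v hv => ?_) fun h =>
      hp0 (inner_self_eq_zero.1 (hperp p (h ▸ hpo) p hp))
    have := hperp u hu _ (AffineSubspace.vadd_mem_of_mem_direction hv hp)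
    rwa [vadd_eq_add, inner_add_right, hperp u hu p hp, add_zero] at this
  have h1 := Submodule.finrank_lt_finrank_of_lt hlt
  have h2 := G.direction.finrank_add_finrank_orthogonal
  rw [affCodim, affDim, affDim]
  omega

/-! ### Strong and weak infeasibility -/

theorem stronglyInfeasible_iff_polarAffine [FiniteDimensional ℝ Y] {H : AffineSubspace ℝ Y}
    {K : ProperCone ℝ Y}
    (hH : (H : Set Y).Nonempty) :
    StronglyInfeasible H K ↔ ¬ Infeasible (polarAffine H) (dual K) := by
  rw [stronglyInfeasible_iff hH, Infeasible, ← Ne, ← Set.nonempty_iff_ne_empty]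
  refine exists_congr fun y => and_comm.trans (and_congr_left fun _ => ?_)
  exact forall₂_congr fun z _ => by rw [real_inner_comm]

theorem StronglyInfeasible.mono [FiniteDimensional ℝ Y] {H H' : AffineSubspace ℝ Y}
    {K : ProperCone ℝ Y}
    (hH : (H : Set Y).Nonempty) (hle : H ≤ H') (h : StronglyInfeasible H' K) :
    StronglyInfeasible H K := by
  obtain ⟨y, hy, hyH⟩ := (stronglyInfeasible_iff (hH.mono hle)).1 h
  exact (stronglyInfeasible_iff hH).2 ⟨y, hy, fun z hz => hyH z (hle hz)⟩

/-- If `0 ∉ H`, the alternative system of `H ∩ K` is the infeasible system of `polarAffine H` and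
`K*`; facial reduction enlarges `polarAffine H`, and the polar of the result is the desired subspace
of `H`. -/
theorem exists_not_stronglyInfeasible_affDim_lt_ell [FiniteDimensional ℝ Y] {K : ProperCone ℝ Y}
    {H : AffineSubspace ℝ Y}
    (hH : (H : Set Y).Nonempty) (hns : ¬ StronglyInfeasible H K) :
    ∃ H'' : AffineSubspace ℝ Y, H'' ≤ H ∧ (H'' : Set Y).Nonempty ∧
      affDim H'' < ell (dual K) ∧ ¬ StronglyInfeasible H'' K := by
  by_cases h0 : (0 : Y) ∈ H
  · refine ⟨AffineSubspace.mk' 0 ⊥, fun z hz => ?_, AffineSubspace.mk'_nonempty _ _, ?_, ?_⟩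
    · have hz0 : z = 0 := by simpa [AffineSubspace.mem_mk'] using hz
      exact hz0 ▸ h0
    · rw [affDim, AffineSubspace.direction_mk', finrank_bot]
      exact one_le_ell _
    · rw [stronglyInfeasible_iff (AffineSubspace.mk'_nonempty _ _)]
      rintro ⟨y, -, hy⟩
      simpa using hy 0 (AffineSubspace.self_mem_mk' _ _)
  · have hinf : Infeasible (polarAffine H) (dual K) := by
      rwa [stronglyInfeasible_iff_polarAffine hH, not_not] at hns
    have hne := polarAffine_nonempty hH h0
    obtain ⟨G, hHG, hcod, hG⟩ := exists_infeasible_affCodim_le_ell hne hinf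
    have hGne : (G : Set Y).Nonempty := hne.mono hHG
    -- The origin belongs to `K*`, so an affine subspace disjoint from `K*` avoids it.
    have hG0 : (0 : Y) ∉ G := fun h => Set.notMem_empty (0 : Y) (hG ▸ ⟨h, (dual K).zero_mem⟩)
    refine ⟨polarAffine G, ?_, polarAffine_nonempty hGne hG0,
      (affDim_polarAffine_lt hGne hG0).trans_le hcod, ?_⟩
    · exact (polarAffine_anti hHG).trans (polarAffine_polarAffine hH h0).le
    · rwa [stronglyInfeasible_iff_polarAffine (polarAffine_nonempty hGne hG0),
        polarAffine_polarAffine hGne hG0, not_not]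

end ConicSystem

theorem corollary1 {Y : Type*} [NormedAddCommGroup Y] [InnerProductSpace ℝ Y]
    [FiniteDimensional ℝ Y] (K : ProperCone ℝ Y) (H : AffineSubspace ℝ Y)
    (hH : (H : Set Y).Nonempty) :
    (ConicSystem.Infeasible H K →
      ∃ H' : AffineSubspace ℝ Y, H ≤ H' ∧
        ConicSystem.affCodim H' ≤ ConicSystem.ell K ∧
        ConicSystem.Infeasible H' K) ∧
    (¬ ConicSystem.StronglyInfeasible H K →
      ∃ H'' : AffineSubspace ℝ Y, H'' ≤ H ∧ (H'' : Set Y).Nonempty ∧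
        (ConicSystem.affDim H'' : ℤ) ≤ (ConicSystem.ell (ConicSystem.dual K) : ℤ) - 1 ∧
        ¬ ConicSystem.StronglyInfeasible H'' K) ∧
    (ConicSystem.WeaklyInfeasible H K →
      ∃ H' H'' : AffineSubspace ℝ Y, H'' ≤ H ∧ H ≤ H' ∧ (H'' : Set Y).Nonempty ∧
        ConicSystem.affCodim H' ≤ ConicSystem.ell K ∧
        (ConicSystem.affDim H'' : ℤ) ≤ (ConicSystem.ell (ConicSystem.dual K) : ℤ) - 1 ∧
        ConicSystem.WeaklyInfeasible H' K ∧
        ConicSystem.WeaklyInfeasible H'' K) := by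
  have enlarge := fun h : ConicSystem.Infeasible H K =>
    ConicSystem.exists_infeasible_affCodim_le_ell hH h
  have shrink : ¬ ConicSystem.StronglyInfeasible H K →
      ∃ H'' : AffineSubspace ℝ Y, H'' ≤ H ∧ (H'' : Set Y).Nonempty ∧
        (ConicSystem.affDim H'' : ℤ) ≤ (ConicSystem.ell (ConicSystem.dual K) : ℤ) - 1 ∧
        ¬ ConicSystem.StronglyInfeasible H'' K := fun h => by
    obtain ⟨H'', hle, hne, hdim, hns⟩ :=
      ConicSystem.exists_not_stronglyInfeasible_affDim_lt_ell hH h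
    exact ⟨H'', hle, hne, by omega, hns⟩
  refine ⟨enlarge, shrink, fun ⟨hinf, hns⟩ => ?_⟩
  obtain ⟨H', hle', hcod, hinf'⟩ := enlarge hinf
  obtain ⟨H'', hle'', hne, hdim, hns''⟩ := shrink hns
  exact ⟨H', H'', hle'', hle', hne, hcod, hdim, ⟨hinf', fun h => hns (h.mono hH hle')⟩,
    Set.eq_empty_of_subset_empty (hinf ▸ Set.inter_subset_inter_left _ hle''), hns''⟩
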